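/- Let $H$ be a complex Hilbert space of finite dimension $N$, let $\Omega, B$ be self-adjoint operators on $H$ with $B\ge 0$ and $0<N_B<N$, where $N_B=\operatorname{rank}B$, and let $A(\beta)=\Omega-\mathrm{i}\beta B$ for real $\beta$. Let $\mathring\zeta_1,\dots,\mathring\zeta_{N_B}$ be any indexing of the nonzero eigenvalues of $B$, counted with multiplicity. By a system of eigenmodes (in the high-loss regime) we mean functions $\zeta_j(\beta)\in\mathbb C$, $w_j(\beta)\in H$, $1\le j\le N$, such that for all sufficiently large $\beta$ one has $A(\beta)w_j(\beta)=\zeta_j(\beta)w_j(\beta)$ for all $j$ and $w_1(\beta),\dots,w_N(\beta)$ are linearly independent; each $w_j$ is analytic at $\beta=\infty$, i.e. $w_j(\beta)=\mathring w_j+w_j^{(-1)}\beta^{-1}+w_j^{(-2)}\beta^{-2}+\cdots$ is a power series in $\beta^{-1}$ convergent for all large $\beta$; the vectors $\mathring w_1,\dots,\mathring w_N$ are orthonormal; $B\mathring w_j=\mathring\zeta_j\mathring w_j$ for $1\le j\le N_B$ (high-loss modes) and $B\mathring w_j=0$ for $N_B+1\le j\le N$ (low-loss modes). Put $\rho_j=(\mathring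 w_j,\Omega\mathring w_j)$ for $1\le j\le N$ and $d_j=(w_j^{(-1)},Bw_j^{(-1)})$ for $N_B+1\le j\le N$. Then a system of eigenmodes exists, and every system of eigenmodes has the following properties. 1. For $1\le j\le N$, $\operatorname{Re}\zeta_j(\beta)$ is analytic at $\beta=\infty$ (a power series in $\beta^{-1}$ convergent for all large $\beta$), and its series contains only even powers of $\beta^{-1}$. 2. $\operatorname{Im}\zeta_j(\beta)$ has a pole at $\beta=\infty$ for $1\le j\le N_B$ and is analytic at $\beta=\infty$ for $N_B+1\le j\le N$; in both cases its (Laurent) series contains only odd powers of $\beta^{-1}$. 3. As $\beta\to\infty$, $$\operatorname{Re}\zeta_j(\beta)=\rho_j+O(\beta^{-2}),\quad \operatorname{Im}\zeta_j(\beta)=-\mathring\zeta_j\,\beta+O(\beta^{-1}),\qquad 1\le j\le N_B;$$ $$\operatorname{Re}\zeta_j(\beta)=\rho_j+O(\beta^{-2}),\quad \operatorname{Im}\zeta_j(\beta)=-d_j\,\beta^{-1}+O(\beta^{-3}),\qquad N_B+1\le j\le N.$$ -/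

import Mathlib

open Filter Asymptotics

/-- The system operator `A(β) = Ω - iβB`. -/
noncomputable def systemOperator {H : Type*} [AddCommGroup H] [Module ℂ H]
    (Ω B : H →ₗ[ℂ] H) (β : ℝ) : H →ₗ[ℂ] H :=
  Ω - (Complex.I * (β : ℂ)) • B

/-- The rank `N_B` of the operator `B`, i.e. the dimension of the loss subspace `ran B`. -/
noncomputable def lossRank {H : Type*} [AddCommGroup H] [Module ℂ H] (B : H →ₗ[ℂ] H) : ℕ :=
  Module.finrank ℂ (LinearMap.range B)

/-- `f` is analytic at `β = ∞`, with expansion `f(β) = ∑_{n ≥ 0} cₙ β⁻ⁿ` convergent for all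
sufficiently large `β`. -/
def HasPowerSeriesAtInfty {E : Type*} [NormedAddCommGroup E] [NormedSpace ℝ E]
    (f : ℝ → E) (c : ℕ → E) : Prop :=
  ∃ R : ℝ, 0 < R ∧ ∀ β : ℝ, R < β → HasSum (fun n : ℕ => (β⁻¹) ^ n • c n) (f β)

/-- `f` is analytic at `β = ∞` up to a possible pole there, with Laurent expansion
`f(β) = ∑ₙ aₙ β⁻ⁿ` (finitely many nonzero `aₙ` with `n < 0`) convergent for all sufficiently
large `β`. -/
def HasLaurentSeriesAtInfty (f : ℝ → ℝ) (a : ℤ → ℝ) : Prop :=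
  (∃ m : ℤ, ∀ n : ℤ, n < m → a n = 0) ∧
    ∃ R : ℝ, 0 < R ∧ ∀ β : ℝ, R < β → HasSum (fun n : ℤ => a n * β ^ (-n)) (f β)

/-- `z` lists all the nonzero eigenvalues of `B` (an operator with real spectrum), counted with
multiplicity. -/
def IsNonzeroEigenvalueIndexing {H : Type*} [AddCommGroup H] [Module ℂ H]
    (B : H →ₗ[ℂ] H) (z : Fin (lossRank B) → ℝ) : Prop :=
  (∀ j, z j ≠ 0) ∧
    ∀ x : ℝ, x ≠ 0 →
      Nat.card {j : Fin (lossRank B) // z j = x} =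
        Module.finrank ℂ (Module.End.eigenspace B (x : ℂ))

/-- The eigenmodes of `A(β) = Ω - iβB` in the high-loss regime: for all large `β` a complete set of
eigenvalues `ζ j β` and eigenvectors `w j β`, the eigenvectors being analytic at `β = ∞` with
`w j β = ∑ₙ β⁻ⁿ c j n`. The limits `c j 0` are orthonormal; they are eigenvectors of `B` for the
nonzero eigenvalues `z j` for the first `rank B` indices `j` (high-loss modes; these limits then
form a basis of `ran B`), and lie in `ker B` for the other indices (low-loss modes). -/
structure IsEigenmodeFamily {H : Type*} [NormedAddCommGroup H] [InnerProductSpace ℂ H]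
    (Ω B : H →ₗ[ℂ] H) (z : Fin (lossRank B) → ℝ)
    (ζ : Fin (Module.finrank ℂ H) → ℝ → ℂ) (w : Fin (Module.finrank ℂ H) → ℝ → H)
    (c : Fin (Module.finrank ℂ H) → ℕ → H) : Prop where
  eigenpair : ∀ᶠ β in atTop, ∀ j, systemOperator Ω B β (w j β) = ζ j β • w j β
  complete : ∀ᶠ β in atTop, LinearIndependent ℂ (fun j => w j β)
  analytic : ∀ j, HasPowerSeriesAtInfty (w j) (c j)
  orthonormal : Orthonormal ℂ (fun j => c j 0)
  highLoss : ∀ (j : Fin (Module.finrank ℂ H)) (hj : (j : ℕ) < lossRank B), B (c j 0) = ((z ⟨j, hj⟩ : ℝ) : ℂ) • c j 0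
  lowLoss : ∀ j : Fin (Module.finrank ℂ H), lossRank B ≤ (j : ℕ) → B (c j 0) = 0

/-! ### Continuation of invariant subspaces by a Riccati equation -/

open scoped Topology ContDiff

/-! With `t = i/β` one has `A(β) = -iβ (B + tΩ)`, and `B + tΩ` is self-adjoint for real `t`. Its
analytic eigenvalues `ν(t)` therefore have real Taylor coefficients, and `ζ(β) = -iβ ν(i/β)`. The
parity claims are the statement that `i^n` is real for even `n` and imaginary for odd `n`; the
leading terms are the perturbation coefficients of `ν` up to order two (`eigenvalue_coeff`).

Existence is Rellich's theorem (`IsAsymptoticallySymmetric.hasAnalyticEigenbasis`), by induction on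
dimension: subtract the mean eigenvalue, divide by a power of `t` until the value at `0` is not
scalar, and continue an eigenspace and its complement analytically. The embeddings of the continued
subspaces are not isometric for `t ≠ 0`, so the induction runs over operators symmetric for a form
`G t → 1`.

For an arbitrary system, the eigenvector equation is known only at the points `i/β`. These
accumulate at `0`, so the identity theorem carries it to real `t`, where the eigenvalue is real. -/

theorem AnalyticAt.clm_comp {X V W : Type*}
    [NormedAddCommGroup V] [NormedSpace ℂ V] [FiniteDimensional ℂ V]
    [NormedAddCommGroup W] [NormedSpace ℂ W] [FiniteDimensional ℂ W]
    [NormedAddCommGroup X] [NormedSpace ℂ X] [FiniteDimensional ℂ X]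
    {g : ℂ → W →L[ℂ] X} {f : ℂ → V →L[ℂ] W} {t : ℂ}
    (hg : AnalyticAt ℂ g t) (hf : AnalyticAt ℂ f t) :
    AnalyticAt ℂ (fun s => g s ∘L f s) t :=
  have : CompleteSpace X := FiniteDimensional.complete ℂ X
  (hg.contDiffAt.clm_comp (hf.contDiffAt (n := ω))).analyticAt

/-- The analytic solution of the Riccati equation `c + d K = K (a + b K)` with `K 0 = 0`. -/
theorem exists_analyticAt_riccati {V W : Type*}
    [NormedAddCommGroup V] [NormedSpace ℂ V] [FiniteDimensional ℂ V]
    [NormedAddCommGroup W] [NormedSpace ℂ W] [FiniteDimensional ℂ W]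
    {a : ℂ → V →L[ℂ] V} {b : ℂ → W →L[ℂ] V} {c : ℂ → V →L[ℂ] W} {d : ℂ → W →L[ℂ] W}
    (ha : AnalyticAt ℂ a 0) (hb : AnalyticAt ℂ b 0) (hc : AnalyticAt ℂ c 0)
    (hd : AnalyticAt ℂ d 0) (hc0 : c 0 = 0)
    (hinj : ∀ K : V →L[ℂ] W, d 0 ∘L K = K ∘L a 0 → K = 0) :
    ∃ K : ℂ → V →L[ℂ] W, AnalyticAt ℂ K 0 ∧ K 0 = 0 ∧
      ∀ᶠ t in 𝓝 0, c t + d t ∘L K t = K t ∘L (a t + b t ∘L K t) := by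
  have : CompleteSpace V := FiniteDimensional.complete ℂ V
  have : CompleteSpace W := FiniteDimensional.complete ℂ W
  let f : ℂ × (V →L[ℂ] W) → (V →L[ℂ] W) := fun p =>
    c p.1 + d p.1 ∘L p.2 - p.2 ∘L (a p.1 + b p.1 ∘L p.2)
  let u : ℂ × (V →L[ℂ] W) := (0, 0)
  have ha' : ContDiffAt ℂ ω (fun p : ℂ × (V →L[ℂ] W) => a p.1) u :=
    ContDiffAt.comp u (g := a) ha.contDiffAt contDiffAt_fst
  have hb' : ContDiffAt ℂ ω (fun p : ℂ × (V →L[ℂ] W) => b p.1) u :=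
    ContDiffAt.comp u (g := b) hb.contDiffAt contDiffAt_fst
  have hc' : ContDiffAt ℂ ω (fun p : ℂ × (V →L[ℂ] W) => c p.1) u :=
    ContDiffAt.comp u (g := c) hc.contDiffAt contDiffAt_fst
  have hd' : ContDiffAt ℂ ω (fun p : ℂ × (V →L[ℂ] W) => d p.1) u :=
    ContDiffAt.comp u (g := d) hd.contDiffAt contDiffAt_fst
  have hf : ContDiffAt ℂ ω f u :=
    (hc'.add (hd'.clm_comp contDiffAt_snd)).sub
      (contDiffAt_snd.clm_comp (ha'.add (hb'.clm_comp contDiffAt_snd)))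
  -- The derivative in `K` at the origin is the Sylvester operator `K ↦ d(0) K - K a(0)`: the term
  -- `K b K` is quadratic. Injectivity suffices in finite dimension.
  let D : (V →L[ℂ] W) →L[ℂ] (V →L[ℂ] W) :=
    ContinuousLinearMap.compL ℂ V W W (d 0) -
      (ContinuousLinearMap.compL ℂ V V W).flip (a 0)
  have hpart : fderiv ℂ f u ∘L .inr ℂ ℂ (V →L[ℂ] W) = D := by
    have h1 : HasFDerivAt (fun K : V →L[ℂ] W => f (0, K))
        (fderiv ℂ f u ∘L .inr ℂ ℂ (V →L[ℂ] W)) 0 := by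
      have h := (hf.differentiableAt (by simp)).hasFDerivAt
      exact h.comp (0 : V →L[ℂ] W) (hasFDerivAt_prodMk_right (0 : ℂ) (0 : V →L[ℂ] W))
    have h2 : HasFDerivAt (fun K : V →L[ℂ] W => f (0, K)) D 0 := by
      have hid : HasFDerivAt (fun K : V →L[ℂ] W => K) (.id ℂ _) 0 := hasFDerivAt_id _
      have := ((hasFDerivAt_const (c 0) (0 : V →L[ℂ] W)).add
        ((hasFDerivAt_const (d 0) (0 : V →L[ℂ] W)).clm_comp hid)).sub
        (hid.clm_comp ((hasFDerivAt_const (a 0) (0 : V →L[ℂ] W)).add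
          ((hasFDerivAt_const (b 0) (0 : V →L[ℂ] W)).clm_comp hid)))
      refine this.congr_fderiv ?_
      ext K x
      simp [D]
    exact h1.unique h2
  have hDinj : Function.Injective D := by
    rw [injective_iff_map_eq_zero]
    intro K hK
    exact hinj K (sub_eq_zero.1 (by simpa [D] using hK))
  have hinv : (fderiv ℂ f u ∘L .inr ℂ ℂ (V →L[ℂ] W)).IsInvertible := by
    rw [hpart]
    exact ⟨(LinearEquiv.ofInjectiveEndo D.toLinearMap hDinj).toContinuousLinearEquiv, by
      ext; rfl⟩
  have h0 : f u = 0 := by simp [f, u, hc0]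
  refine ⟨hf.implicitFunction (by simp) hinv, ?_, hf.implicitFunction_apply_self _ _, ?_⟩
  · exact (hf.contDiffAt_implicitFunction (by simp) hinv).analyticAt
  · filter_upwards [hf.eventually_apply_implicitFunction (by simp) hinv] with t ht
    rw [h0] at ht
    exact sub_eq_zero.1 ht

/-- An invariant subspace of `C 0` which has an invariant orthogonal complement without common
spectrum continues to an analytic family of invariant subspaces of `C t`. -/
theorem exists_analyticAt_invariant_embedding {E : Type*} [NormedAddCommGroup E]
    [InnerProductSpace ℂ E] [FiniteDimensional ℂ E] {C : ℂ → E →L[ℂ] E}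
    (hC : AnalyticAt ℂ C 0) (V W : Submodule ℂ E) (hVW : W = Vᗮ)
    (hV : ∀ x ∈ V, C 0 x ∈ V) (hW : ∀ x ∈ W, C 0 x ∈ W)
    (hinj : ∀ K : V →L[ℂ] W, (∀ x : V, C 0 (K x) = K ⟨C 0 x, hV x x.2⟩) → K = 0) :
    ∃ (J : ℂ → V →L[ℂ] E) (S : ℂ → V →L[ℂ] V), AnalyticAt ℂ J 0 ∧ AnalyticAt ℂ S 0 ∧
      J 0 = V.subtypeL ∧ ∀ᶠ t in 𝓝 0, C t ∘L J t = J t ∘L S t := by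
  have hdec : ∀ x : E, (V.orthogonalProjectionOnto x : E) + W.orthogonalProjectionOnto x = x := by
    intro x
    subst hVW
    exact V.starProjection_add_starProjection_orthogonal x
  have hK (U U' : Submodule ℂ E) : AnalyticAt ℂ
      (fun t => U.orthogonalProjectionOnto ∘L C t ∘L U'.subtypeL) 0 :=
    AnalyticAt.clm_comp analyticAt_const (hC.clm_comp analyticAt_const)
  have hc0 : W.orthogonalProjectionOnto ∘L C 0 ∘L V.subtypeL = 0 := by
    ext x
    have : W.orthogonalProjectionOnto (C 0 x) = 0 := by
      rw [Submodule.orthogonalProjectionOnto_eq_zero_iff, hVW, Submodule.orthogonal_orthogonal]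
      exact hV x x.2
    simp [this]
  obtain ⟨K, hKan, hK0, hKeq⟩ := exists_analyticAt_riccati (hK V V) (hK V W) (hK W V) (hK W W) hc0
    (by
      intro K hK
      refine hinj K fun x => ?_
      have h1 := congrArg (fun L : V →L[ℂ] W => ((L x : W) : E)) hK
      have h2 : (W.orthogonalProjectionOnto (C 0 (K x)) : E) = C 0 (K x) :=
        Submodule.starProjection_eq_self_iff.2 (hW _ (K x).2)
      have h3 : V.orthogonalProjectionOnto (C 0 x) = ⟨C 0 x, hV x x.2⟩ :=
        Subtype.ext (Submodule.starProjection_eq_self_iff.2 (hV _ x.2))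
      simp only [ContinuousLinearMap.comp_apply, Submodule.subtypeL_apply, h2, h3] at h1
      exact h1)
  -- The invariant subspace is the graph of `K t : V → W`; the Riccati equation is exactly its
  -- invariance, and `a + b K` is the induced operator.
  refine ⟨fun t => V.subtypeL + W.subtypeL ∘L K t,
    fun t => V.orthogonalProjectionOnto ∘L C t ∘L V.subtypeL +
      (V.orthogonalProjectionOnto ∘L C t ∘L W.subtypeL) ∘L K t,
    analyticAt_const.add (analyticAt_const.clm_comp hKan),
    (hK V V).add ((hK V W).clm_comp hKan), by simp [hK0], ?_⟩
  filter_upwards [hKeq] with t ht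
  ext x
  have h1 := congrArg (fun L : V →L[ℂ] W => ((L x : W) : E)) ht
  simp only [ContinuousLinearMap.comp_apply, Submodule.subtypeL_apply,
    add_apply, Submodule.coe_add] at h1 ⊢
  rw [← h1, ← hdec (C t _)]
  simp only [map_add, Submodule.coe_add]

/-! ### Rellich's theorem -/

section Rellich

universe u

variable {E : Type u} [NormedAddCommGroup E] [InnerProductSpace ℂ E] [FiniteDimensional ℂ E]

/-- The trace as a continuous linear functional on the bounded operators. -/
noncomputable def traceCLM (E : Type*) [NormedAddCommGroup E] [InnerProductSpace ℂ E]
    [FiniteDimensional ℂ E] : (E →L[ℂ] E) →L[ℂ] ℂ :=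
  LinearMap.toContinuousLinearMap
    ((LinearMap.trace ℂ E) ∘ₗ ContinuousLinearMap.coeLM ℂ)

theorem traceCLM_apply (T : E →L[ℂ] E) : traceCLM E T = LinearMap.trace ℂ E T := rfl

theorem traceCLM_mul_comm (S T : E →L[ℂ] E) : traceCLM E (S * T) = traceCLM E (T * S) :=
  LinearMap.trace_mul_comm ℂ (S : E →ₗ[ℂ] E) T

theorem traceCLM_one : traceCLM E 1 = Module.finrank ℂ E :=
  LinearMap.trace_one ℂ E

theorem traceCLM_star (T : E →L[ℂ] E) : traceCLM E (star T) = star (traceCLM E T) := by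
  rw [traceCLM_apply, traceCLM_apply, LinearMap.trace_eq_sum_inner _ (stdOrthonormalBasis ℂ E),
    LinearMap.trace_eq_sum_inner _ (stdOrthonormalBasis ℂ E), star_sum]
  refine Finset.sum_congr rfl fun i _ => ?_
  have := ContinuousLinearMap.adjoint_inner_right T (stdOrthonormalBasis ℂ E i)
    (stdOrthonormalBasis ℂ E i)
  exact this.trans (inner_conj_symm _ _).symm

/-- An operator which is self-adjoint with respect to an invertible Hermitian form has real
trace. -/
theorem traceCLM_isSelfAdjoint {G S : E →L[ℂ] E} (hG : IsSelfAdjoint G) (hu : IsUnit G)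
    (hGS : IsSelfAdjoint (G * S)) : IsSelfAdjoint (traceCLM E S) := by
  obtain ⟨U, rfl⟩ := hu
  have h1 : star S * U = U * S := by
    have := hGS.star_eq
    rwa [star_mul, hG.star_eq] at this
  -- The adjoint of `S` is similar to `S`, so both have the same trace.
  have h2 : star S = U * S * ↑U⁻¹ := by
    rw [← h1, mul_assoc, Units.mul_inv, mul_one]
  rw [IsSelfAdjoint, ← traceCLM_star, h2, traceCLM_mul_comm, ← mul_assoc, Units.inv_mul, one_mul]

/-- `S t` is, for small real `t ≠ 0`, self-adjoint with respect to a Hermitian form `G t` which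
tends to the given inner product as `t → 0`. -/
def IsAsymptoticallySymmetric (S : ℂ → E →L[ℂ] E) : Prop :=
  ∃ G : ℝ → E →L[ℂ] E, Tendsto G (𝓝[≠] 0) (𝓝 1) ∧
    ∀ᶠ t : ℝ in 𝓝[≠] 0, IsSelfAdjoint (G t) ∧ IsSelfAdjoint (G t * S t)

/-- Near `0` there is an analytic family of eigenpairs of `S t`, the eigenvectors forming an
orthonormal basis at `t = 0`. -/
def HasAnalyticEigenbasis (S : ℂ → E →L[ℂ] E) : Prop :=
  ∃ (ι : Type) (_ : Fintype ι) (v : ι → ℂ → E) (ν : ι → ℂ → ℂ),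
    Fintype.card ι = Module.finrank ℂ E ∧ (∀ i, AnalyticAt ℂ (v i) 0) ∧
    (∀ i, AnalyticAt ℂ (ν i) 0) ∧ (∀ i, ∀ᶠ t in 𝓝 0, S t (v i t) = ν i t • v i t) ∧
    Orthonormal ℂ (fun i => v i 0)

theorem tendsto_ofReal_nhdsNE_zero : Tendsto (fun t : ℝ => (t : ℂ)) (𝓝[≠] 0) (𝓝 0) := by
  have : Tendsto (fun t : ℝ => (t : ℂ)) (𝓝 0) (𝓝 ((0 : ℝ) : ℂ)) :=
    Complex.continuous_ofReal.tendsto 0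
  rw [Complex.ofReal_zero] at this
  exact this.mono_left nhdsWithin_le_nhds

theorem IsAsymptoticallySymmetric.eventually_star_trace {S : ℂ → E →L[ℂ] E}
    {G : ℝ → E →L[ℂ] E} (hG : Tendsto G (𝓝[≠] 0) (𝓝 1))
    (hS : ∀ᶠ t : ℝ in 𝓝[≠] 0, IsSelfAdjoint (G t) ∧ IsSelfAdjoint (G t * S t)) :
    ∀ᶠ t : ℝ in 𝓝[≠] 0, IsSelfAdjoint (traceCLM E (S t)) := by
  have hu : ∀ᶠ t in 𝓝[≠] 0, IsUnit (G t) :=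
    hG.eventually (Units.nhds (1 : (E →L[ℂ] E)ˣ))
  filter_upwards [hS, hu] with t h1 h2
  exact traceCLM_isSelfAdjoint h1.1 h2 h1.2

theorem IsAsymptoticallySymmetric.isSelfAdjoint_zero {S : ℂ → E →L[ℂ] E}
    (hS : IsAsymptoticallySymmetric S) (hc : ContinuousAt S 0) : IsSelfAdjoint (S 0) := by
  obtain ⟨G, hG, h⟩ := hS
  have h1 : Tendsto (fun t : ℝ => G t * S t) (𝓝[≠] 0) (𝓝 (1 * S 0)) :=
    hG.mul (hc.tendsto.comp tendsto_ofReal_nhdsNE_zero)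
  rw [one_mul] at h1
  refine tendsto_nhds_unique (h1.star.congr' ?_) h1
  filter_upwards [h] with t ht using ht.2.star_eq

/-- Removing the trace and the largest power of `t`. -/
theorem IsAsymptoticallySymmetric.exists_reduction {S : ℂ → E →L[ℂ] E}
    (hS : IsAsymptoticallySymmetric S) (hSan : AnalyticAt ℂ S 0) :
    ∃ τ : ℂ → ℂ, AnalyticAt ℂ τ 0 ∧ ((∀ᶠ t in 𝓝 0, S t = τ t • 1) ∨
      ∃ (k : ℕ) (C : ℂ → E →L[ℂ] E), AnalyticAt ℂ C 0 ∧ (∀ μ : ℂ, C 0 ≠ μ • 1) ∧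
        IsAsymptoticallySymmetric C ∧ ∀ᶠ t in 𝓝 0, S t = τ t • 1 + t ^ k • C t) := by
  obtain ⟨G, hG, h⟩ := hS
  set n : ℂ := (Module.finrank ℂ E : ℂ) with hn
  set τ : ℂ → ℂ := fun t => n⁻¹ * traceCLM E (S t) with hτ
  have hτan : AnalyticAt ℂ τ 0 :=
    analyticAt_const.mul ((traceCLM E).analyticAt _ |>.comp hSan)
  refine ⟨τ, hτan, ?_⟩
  have hSτ : AnalyticAt ℂ (fun t => S t - τ t • (1 : E →L[ℂ] E)) 0 :=
    hSan.sub (hτan.smul analyticAt_const)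
  by_cases hz : ∀ᶠ t in 𝓝 0, S t - τ t • (1 : E →L[ℂ] E) = 0
  · left
    filter_upwards [hz] with t ht using sub_eq_zero.1 ht
  right
  obtain ⟨k, C, hCan, hC0, hC⟩ := hSτ.exists_eventuallyEq_pow_smul_nonzero_iff.2 hz
  simp only [sub_zero] at hC
  have hnt : Nontrivial E := by
    by_contra hE
    rw [not_nontrivial_iff_subsingleton] at hE
    exact hC0 (Subsingleton.elim _ _)
  have hn0 : n ≠ 0 := by
    rw [hn]
    exact_mod_cast (Module.finrank_pos (R := ℂ) (M := E)).ne'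
  -- `C t` is traceless for `t ≠ 0`, hence at `0` by continuity. A nonzero traceless operator is not
  -- scalar.
  have htr : traceCLM E (C 0) = 0 := by
    have h1 : Tendsto (fun t : ℂ => traceCLM E (C t)) (𝓝[≠] 0) (𝓝 (traceCLM E (C 0))) :=
      ((traceCLM E).continuous.continuousAt.comp hCan.continuousAt).tendsto.mono_left
        nhdsWithin_le_nhds
    refine tendsto_nhds_unique (h1.congr' ?_) tendsto_const_nhds
    filter_upwards [nhdsWithin_le_nhds hC, self_mem_nhdsWithin] with t ht ht0
    have h2 := congrArg (traceCLM E) ht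
    rw [map_sub, map_smul, map_smul, traceCLM_one, smul_eq_mul, smul_eq_mul, hτ] at h2
    have h3 : n⁻¹ * traceCLM E (S t) * n = traceCLM E (S t) := by field_simp
    rw [h3, sub_self] at h2
    exact (mul_eq_zero.1 h2.symm).resolve_left (pow_ne_zero _ ht0)
  refine ⟨k, C, hCan, ?_, ⟨G, hG, ?_⟩, ?_⟩
  · intro μ hμ
    rw [hμ, map_smul, traceCLM_one, smul_eq_mul] at htr
    rw [(mul_eq_zero.1 htr).resolve_right hn0, zero_smul] at hμ
    exact hC0 hμ
  -- For real `t` both `t ^ k` and the mean eigenvalue `τ t` are real, so the same form `G t` serves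
  -- for `C`.
  · filter_upwards [h, tendsto_ofReal_nhdsNE_zero.eventually hC, self_mem_nhdsWithin,
      IsAsymptoticallySymmetric.eventually_star_trace hG h] with t h1 h2 ht0 h3
    refine ⟨h1.1, ?_⟩
    have ht : ((t : ℂ) ^ k) ≠ 0 := pow_ne_zero _ (by exact_mod_cast ht0)
    have h4 : C t = ((t : ℂ) ^ k)⁻¹ • (S t - τ t • 1) := by
      rw [h2, smul_smul, inv_mul_cancel₀ ht, one_smul]
    have h5 : IsSelfAdjoint (((t : ℂ) ^ k)⁻¹) := by
      simp [IsSelfAdjoint]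
    have h6 : IsSelfAdjoint (τ t) := by
      rw [IsSelfAdjoint, hτ, star_mul', h3.star_eq, hn]
      simp
    rw [h4, mul_smul_comm, mul_sub, mul_smul_comm, mul_one]
    exact h5.smul (h1.2.sub (h6.smul h1.1))
  · filter_upwards [hC] with t ht
    rw [← ht]
    abel

/-- The form pulls back to `J* G J`, and `J* (G C) J = (J* G J) S` by intertwining. Since `J 0` is
an isometric inclusion, the new form still tends to `1`. -/
theorem IsAsymptoticallySymmetric.pullback {C : ℂ → E →L[ℂ] E}
    (hC : IsAsymptoticallySymmetric C) {V : Submodule ℂ E} {J : ℂ → V →L[ℂ] E}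
    {S : ℂ → V →L[ℂ] V} (hJ : ContinuousAt J 0) (hJ0 : J 0 = V.subtypeL)
    (hJS : ∀ᶠ t in 𝓝 0, C t ∘L J t = J t ∘L S t) : IsAsymptoticallySymmetric S := by
  obtain ⟨G, hG, h⟩ := hC
  refine ⟨fun t => (J t).adjoint ∘L G t ∘L J t, ?_, ?_⟩
  · have h1 : Tendsto (fun t : ℝ => J t) (𝓝[≠] 0) (𝓝 (J 0)) :=
      hJ.tendsto.comp tendsto_ofReal_nhdsNE_zero
    have h2 := ((ContinuousLinearMap.adjoint (𝕜 := ℂ) (E := V) (F := E)).continuous.tendsto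
      (J 0)).comp h1
    have h3 := ((((continuous_fst.comp continuous_snd).clm_comp
      (continuous_snd.comp continuous_snd)) |> continuous_fst.clm_comp).tendsto
      ((J 0).adjoint, (1 : E →L[ℂ] E), J 0)).comp (h2.prodMk_nhds (hG.prodMk_nhds h1))
    have h4 : (J 0).adjoint ∘L 1 ∘L J 0 = 1 := by
      rw [hJ0]
      refine ContinuousLinearMap.ext fun x => ext_inner_left ℂ fun y => ?_
      rw [ContinuousLinearMap.comp_apply, ContinuousLinearMap.adjoint_inner_right]
      rfl
    rw [← h4]
    exact h3
  · filter_upwards [h, tendsto_ofReal_nhdsNE_zero.eventually hJS] with t h1 h2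
    refine ⟨h1.1.adjoint_conj (J t), ?_⟩
    have h3 := h1.2.adjoint_conj (J t)
    have h4 : (J t).adjoint ∘L (G t * C t) ∘L J t = ((J t).adjoint ∘L G t ∘L J t) * S t := by
      ext x
      have := congrArg (fun L : V →L[ℂ] E => L x) h2
      simp only [ContinuousLinearMap.comp_apply, mul_apply_eq_comp] at this ⊢
      rw [this]
    rwa [h4] at h3

/-- Only the values at `t = 0` need be orthonormal, and there the two families lie in orthogonal
subspaces. -/
theorem HasAnalyticEigenbasis.of_invariant_embeddings {C : ℂ → E →L[ℂ] E} {V W : Submodule ℂ E}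
    (hVW : W = Vᗮ) {J : ℂ → V →L[ℂ] E} {S : ℂ → V →L[ℂ] V} {J' : ℂ → W →L[ℂ] E}
    {S' : ℂ → W →L[ℂ] W} (hJ : AnalyticAt ℂ J 0) (hJ0 : J 0 = V.subtypeL)
    (hJS : ∀ᶠ t in 𝓝 0, C t ∘L J t = J t ∘L S t) (hJ' : AnalyticAt ℂ J' 0)
    (hJ0' : J' 0 = W.subtypeL) (hJS' : ∀ᶠ t in 𝓝 0, C t ∘L J' t = J' t ∘L S' t)
    (hS : HasAnalyticEigenbasis S) (hS' : HasAnalyticEigenbasis S') :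
    HasAnalyticEigenbasis C := by
  obtain ⟨ι, _, v, ν, hcard, hv, hν, hev, hon⟩ := hS
  obtain ⟨ι', _, v', ν', hcard', hv', hν', hev', hon'⟩ := hS'
  refine ⟨ι ⊕ ι', inferInstance, Sum.elim (fun i t => J t (v i t)) (fun i t => J' t (v' i t)),
    Sum.elim ν ν', ?_, ?_, ?_, ?_, ?_⟩
  · rw [Fintype.card_sum, hcard, hcard', hVW, V.finrank_add_finrank_orthogonal]
  · rintro (i | i)
    · exact (hJ.contDiffAt.clm_apply ((hv i).contDiffAt (n := ω))).analyticAt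
    · exact (hJ'.contDiffAt.clm_apply ((hv' i).contDiffAt (n := ω))).analyticAt
  · rintro (i | i)
    · exact hν i
    · exact hν' i
  · rintro (i | i)
    · filter_upwards [hJS, hev i] with t h1 h2
      have := congrArg (fun L : V →L[ℂ] E => L (v i t)) h1
      simp only [ContinuousLinearMap.comp_apply, h2, map_smul] at this
      exact this
    · filter_upwards [hJS', hev' i] with t h1 h2
      have := congrArg (fun L : W →L[ℂ] E => L (v' i t)) h1
      simp only [ContinuousLinearMap.comp_apply, h2, map_smul] at this
      exact this
  · have key (i : ι) (j : ι') : inner ℂ (v i 0 : E) (v' j 0 : E) = 0 :=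
      V.inner_right_of_mem_orthogonal (v i 0).2 (hVW.le (v' j 0).2)
    constructor
    · rintro (i | i)
      · simpa [hJ0] using hon.1 i
      · simpa [hJ0'] using hon'.1 i
    · rintro (i | i) (j | j) hij
      · simpa [hJ0] using hon.2 (fun h => hij (congrArg _ h))
      · simpa [hJ0, hJ0'] using key i j
      · simpa [hJ0, hJ0'] using inner_eq_zero_symm.1 (key j i)
      · simpa [hJ0'] using hon'.2 (fun h => hij (congrArg _ h))

end Rellich

theorem HasAnalyticEigenbasis.of_smul_add {E : Type*} [NormedAddCommGroup E]
    [InnerProductSpace ℂ E] {S C : ℂ → E →L[ℂ] E} {τ : ℂ → ℂ} {k : ℕ}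
    (hC : HasAnalyticEigenbasis C) (hτ : AnalyticAt ℂ τ 0)
    (h : ∀ᶠ t in 𝓝 0, S t = τ t • 1 + t ^ k • C t) : HasAnalyticEigenbasis S := by
  obtain ⟨ι, _, v, ν, hcard, hv, hν, hev, hon⟩ := hC
  refine ⟨ι, _, v, fun i t => τ t + t ^ k * ν i t, hcard, hv,
    fun i => hτ.add ((analyticAt_id.pow k).mul (hν i)), fun i => ?_, hon⟩
  filter_upwards [h, hev i] with t h1 h2
  simp [h1, h2, add_smul, mul_smul]

/-- Rellich's theorem: an analytic family of operators that are self-adjoint for real parameters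
has analytic eigenvectors and eigenvalues near `0`. -/
theorem IsAsymptoticallySymmetric.hasAnalyticEigenbasis.{u} (n : ℕ) :
    ∀ (E : Type u) [NormedAddCommGroup E] [InnerProductSpace ℂ E] [FiniteDimensional ℂ E],
      Module.finrank ℂ E = n → ∀ S : ℂ → E →L[ℂ] E, AnalyticAt ℂ S 0 →
      IsAsymptoticallySymmetric S → HasAnalyticEigenbasis S := by
  induction n using Nat.strong_induction_on with
  | _ n ih =>
  intro E _ _ _ hE S hSan hS
  obtain ⟨τ, hτ, hscal | ⟨k, C, hCan, hC0, hC, hSC⟩⟩ := hS.exists_reduction hSan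
  · refine ⟨Fin (Module.finrank ℂ E), inferInstance, fun i _ => stdOrthonormalBasis ℂ E i,
      fun _ => τ, by simp, fun _ => analyticAt_const, fun _ => hτ, fun i => ?_,
      (stdOrthonormalBasis ℂ E).orthonormal⟩
    filter_upwards [hscal] with t ht
    simp [ht]
  refine HasAnalyticEigenbasis.of_smul_add (C := C) ?_ hτ hSC
  have hnt : Nontrivial E := by
    by_contra hE
    rw [not_nontrivial_iff_subsingleton] at hE
    exact hC0 0 (Subsingleton.elim _ _)
  obtain ⟨μ, hμ⟩ := Module.End.exists_eigenvalue (C 0 : E →ₗ[ℂ] E)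
  set V : Submodule ℂ E := Module.End.eigenspace (C 0 : E →ₗ[ℂ] E) μ with hVdef
  have hmem (x : E) : x ∈ V ↔ C 0 x = μ • x := Module.End.mem_eigenspace_iff
  have hV : ∀ x ∈ V, C 0 x ∈ V := fun x hx => by
    rw [(hmem x).1 hx]
    exact V.smul_mem _ hx
  have hsymm := (hC.isSelfAdjoint_zero hCan.continuousAt).isSymmetric
  have hW : ∀ x ∈ Vᗮ, C 0 x ∈ Vᗮ := fun x hx => by
    rw [Submodule.mem_orthogonal]
    intro y hy
    have h1 : inner ℂ (C 0 y) x = inner ℂ y (C 0 x) := hsymm y x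
    rw [← h1, (hmem y).1 hy, inner_smul_left, V.inner_right_of_mem_orthogonal hy hx, mul_zero]
  have hdisj (x : E) (hx : x ∈ V) (hx' : x ∈ Vᗮ) : x = 0 :=
    (Submodule.disjoint_def.1 V.orthogonal_disjoint) x hx hx'
  -- `C 0` is not scalar, so the eigenspace and its complement both have smaller dimension.
  have hVtop : V ≠ ⊤ := fun h => hC0 μ (by
    ext x
    have : x ∈ V := h ▸ Submodule.mem_top
    simpa using (hmem x).1 this)
  have hVbot : V ≠ ⊥ := hμ
  have hVlt : Module.finrank ℂ V < n := hE ▸ Submodule.finrank_lt hVtop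
  have hWlt : Module.finrank ℂ (Vᗮ : Submodule ℂ E) < n :=
    hE ▸ Submodule.finrank_lt (fun h => hVbot (by rwa [Submodule.orthogonal_eq_top_iff] at h))
  obtain ⟨J, S₁, hJ, hS₁, hJ0, hJS⟩ := exists_analyticAt_invariant_embedding hCan V Vᗮ rfl hV hW
    (by
      intro K hK
      ext x
      have h1 : C 0 (K x) = μ • (K x : E) := by
        rw [hK x]
        have : (⟨C 0 x, hV x x.2⟩ : V) = μ • x := Subtype.ext ((hmem x).1 x.2)
        rw [this, map_smul]
        rfl
      exact hdisj _ ((hmem _).2 h1) (K x).2)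
  obtain ⟨J', S₂, hJ', hS₂, hJ0', hJS'⟩ := exists_analyticAt_invariant_embedding hCan Vᗮ V
    V.orthogonal_orthogonal.symm hW hV
    (by
      intro K hK
      -- `C 0 - μ` is bijective on `Vᗮ`, while an intertwiner into `V` kills its range.
      let N : (Vᗮ : Submodule ℂ E) →ₗ[ℂ] (Vᗮ : Submodule ℂ E) :=
        (C 0 : E →ₗ[ℂ] E).restrict hW - μ • 1
      have hN : Function.Injective N := by
        rw [injective_iff_map_eq_zero]
        intro x hx
        have h1 := congrArg (Subtype.val) hx
        refine Subtype.ext (hdisj x ((hmem _).2 (sub_eq_zero.1 ?_)) x.2)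
        simpa [N] using h1
      ext y
      obtain ⟨x, rfl⟩ := LinearMap.injective_iff_surjective.1 hN y
      have h1 : N x = ⟨C 0 x, hW x x.2⟩ - μ • x := rfl
      rw [h1, map_sub, map_smul]
      simp only [Submodule.coe_sub, Submodule.coe_smul, ← hK x, (hmem _).1 (K x).2]
      simp)
  exact HasAnalyticEigenbasis.of_invariant_embeddings rfl hJ hJ0 hJS hJ' hJ0' hJS'
    (ih _ hVlt V rfl S₁ hS₁ (hC.pullback hJ.continuousAt hJ0 hJS))
    (ih _ hWlt _ rfl S₂ hS₂ (hC.pullback hJ'.continuousAt hJ0' hJS'))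

/-! ### Power series in `t` and expansions at `β = ∞` -/

/-- The power series in one variable with coefficients `a n`. -/
noncomputable def coeffSeries (𝕜 : Type*) {E : Type*} [NontriviallyNormedField 𝕜]
    [NormedAddCommGroup E] [NormedSpace 𝕜 E] (a : ℕ → E) : FormalMultilinearSeries 𝕜 𝕜 E :=
  fun n => ContinuousMultilinearMap.mkPiRing 𝕜 (Fin n) (a n)

theorem coeff_coeffSeries {𝕜 E : Type*} [NontriviallyNormedField 𝕜]
    [NormedAddCommGroup E] [NormedSpace 𝕜 E] (a : ℕ → E) (n : ℕ) :
    (coeffSeries 𝕜 a).coeff n = a n := by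
  simp [FormalMultilinearSeries.coeff, coeffSeries]

theorem hasFPowerSeriesAt_coeffSeries_iff {𝕜 E : Type*} [NontriviallyNormedField 𝕜]
    [NormedAddCommGroup E] [NormedSpace 𝕜 E] {f : 𝕜 → E} {a : ℕ → E} :
    HasFPowerSeriesAt f (coeffSeries 𝕜 a) 0 ↔ ∀ᶠ z in 𝓝 0, HasSum (fun n => z ^ n • a n) (f z) := by
  simp only [hasFPowerSeriesAt_iff, coeff_coeffSeries, zero_add]

/-- A power series which converges at some point `z₀ ≠ 0` defines an analytic function. -/
theorem exists_eventually_hasSum_of_summable {𝕜 E : Type*} [NontriviallyNormedField 𝕜]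
    [NormedAddCommGroup E] [NormedSpace 𝕜 E] [CompleteSpace E] {a : ℕ → E} {z₀ : 𝕜}
    (hz : z₀ ≠ 0) (h : Summable (fun n => z₀ ^ n • a n)) :
    ∃ f : 𝕜 → E, ∀ᶠ z in 𝓝 0, HasSum (fun n => z ^ n • a n) (f z) := by
  let p : FormalMultilinearSeries 𝕜 𝕜 E := coeffSeries 𝕜 a
  have hle : (‖z₀‖₊ : ENNReal) ≤ p.radius := by
    refine p.le_radius_of_tendsto (l := 0) ?_
    have := h.tendsto_atTop_zero.norm
    simpa [p, coeffSeries, norm_smul, mul_comm] using this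
  have hpos : 0 < p.radius := lt_of_lt_of_le (by simpa using hz) hle
  exact ⟨p.sum, hasFPowerSeriesAt_coeffSeries_iff.1 (p.hasFPowerSeriesOnBall hpos).hasFPowerSeriesAt⟩

theorem hasPowerSeriesAtInfty_iff {E : Type*} [NormedAddCommGroup E] [NormedSpace ℝ E]
    {f : ℝ → E} {c : ℕ → E} : HasPowerSeriesAtInfty f c ↔
      ∀ᶠ β in atTop, HasSum (fun n : ℕ => (β⁻¹) ^ n • c n) (f β) := by
  constructor
  · rintro ⟨R, -, h⟩
    filter_upwards [eventually_gt_atTop R] with β hβ using h β hβ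
  · intro h
    obtain ⟨R, hR⟩ := eventually_atTop.1 h
    exact ⟨max R 1, by positivity, fun β hβ => hR β ((le_max_left _ _).trans hβ.le)⟩

theorem tendsto_I_div_atTop : Tendsto (fun β : ℝ => Complex.I / (β : ℂ)) atTop (𝓝[≠] 0) := by
  rw [tendsto_nhdsWithin_iff]
  constructor
  · rw [tendsto_zero_iff_norm_tendsto_zero]
    refine tendsto_inv_atTop_zero.congr' ?_
    filter_upwards [eventually_gt_atTop 0] with β hβ
    simp [abs_of_pos hβ]
  · filter_upwards [eventually_gt_atTop 0] with β hβ
    simp [hβ.ne']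

theorem I_div_pow_smul {E : Type*} [NormedAddCommGroup E] [NormedSpace ℂ E] (β : ℝ) (n : ℕ)
    (x : E) : (Complex.I / (β : ℂ)) ^ n • x = (β⁻¹) ^ n • (Complex.I ^ n • x) := by
  rw [← Complex.coe_smul, smul_smul]
  congr 1
  push_cast
  rw [div_eq_mul_inv, mul_pow, mul_comm]

theorem HasPowerSeriesAtInfty.of_hasSum {E : Type*} [NormedAddCommGroup E] [NormedSpace ℂ E]
    {f : ℂ → E} {a : ℕ → E} (h : ∀ᶠ z in 𝓝 0, HasSum (fun n => z ^ n • a n) (f z)) :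
    HasPowerSeriesAtInfty (fun β => f (Complex.I / β)) (fun n => Complex.I ^ n • a n) := by
  rw [hasPowerSeriesAtInfty_iff]
  filter_upwards [(tendsto_I_div_atTop.mono_right nhdsWithin_le_nhds).eventually h] with β hβ
  simpa only [I_div_pow_smul] using hβ

/-- Convergence at a single large `β` gives a disc of convergence in complex `t`. The factor
`(-i)^n` undoes the `i^n` of `t = i/β`. -/
theorem HasPowerSeriesAtInfty.exists_hasSum {E : Type*} [NormedAddCommGroup E] [NormedSpace ℂ E]
    [CompleteSpace E] {f : ℝ → E} {c : ℕ → E} (h : HasPowerSeriesAtInfty f c) :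
    ∃ F : ℂ → E, (∀ᶠ z in 𝓝 0, HasSum (fun n => z ^ n • ((-Complex.I) ^ n • c n)) (F z)) ∧
      ∀ᶠ β : ℝ in atTop, f β = F (Complex.I / β) := by
  rw [hasPowerSeriesAtInfty_iff] at h
  have h' : ∀ᶠ β : ℝ in atTop,
      HasSum (fun n => (Complex.I / (β : ℂ)) ^ n • ((-Complex.I) ^ n • c n)) (f β) := by
    filter_upwards [h] with β hβ
    have (n : ℕ) : (Complex.I / (β : ℂ)) ^ n • ((-Complex.I) ^ n • c n) = (β⁻¹) ^ n • c n := by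
      rw [I_div_pow_smul, smul_smul, ← mul_pow]
      simp
    simpa only [this] using hβ
  obtain ⟨β₀, hβ₀, hpos⟩ := (h'.and (eventually_gt_atTop 0)).exists
  obtain ⟨F, hF⟩ := exists_eventually_hasSum_of_summable (z₀ := Complex.I / (β₀ : ℂ))
    (by simp [hpos.ne']) hβ₀.summable
  refine ⟨F, hF, ?_⟩
  filter_upwards [(tendsto_I_div_atTop.mono_right nhdsWithin_le_nhds).eventually hF, h']
    with β h1 h2 using h2.unique h1

theorem HasPowerSeriesAtInfty.isBigO_sub_sum {f : ℝ → ℝ} {a : ℕ → ℝ}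
    (h : HasPowerSeriesAtInfty f a) (m : ℕ) :
    (fun β => f β - ∑ n ∈ Finset.range m, (β⁻¹) ^ n * a n)
      =O[atTop] fun β : ℝ => β ^ (-(m : ℤ)) := by
  rw [hasPowerSeriesAtInfty_iff] at h
  obtain ⟨β₀, hβ₀, hpos⟩ := (h.and (eventually_gt_atTop 0)).exists
  obtain ⟨F, hF⟩ := exists_eventually_hasSum_of_summable (z₀ := β₀⁻¹)
    (by simp [hpos.ne']) hβ₀.summable
  have h1 := ((hasFPowerSeriesAt_coeffSeries_iff.2 hF).isBigO_sub_partialSum_pow m).comp_tendsto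
    tendsto_inv_atTop_zero
  refine h1.congr' ?_ ?_
  · filter_upwards [tendsto_inv_atTop_zero.eventually hF, h] with β h2 h3
    simp [FormalMultilinearSeries.partialSum, coeff_coeffSeries, h3.unique h2]
  · filter_upwards [eventually_gt_atTop 0] with β hβ
    simp [abs_of_pos hβ]

/-- A power series which is real on the real axis has real coefficients. -/
theorem exists_real_coeff {f : ℂ → ℂ} (hf : AnalyticAt ℂ f 0)
    (hreal : ∀ᶠ t : ℝ in 𝓝 0, (f t).im = 0) :
    ∃ r : ℕ → ℝ, ∀ᶠ z in 𝓝 0, HasSum (fun n => z ^ n • (r n : ℂ)) (f z) := by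
  obtain ⟨p, hp⟩ := hf
  have h := hasFPowerSeriesAt_iff.1 hp
  have ht : Tendsto (fun t : ℝ => (t : ℂ)) (𝓝 0) (𝓝 0) := by
    have := Complex.continuous_ofReal.tendsto 0
    rwa [Complex.ofReal_zero] at this
  -- The imaginary parts of the coefficients form a real power series with sum zero.
  have h0 : ∀ᶠ t : ℝ in 𝓝 0, HasSum (fun n => t ^ n • (p.coeff n).im) 0 := by
    filter_upwards [ht.eventually h, hreal] with t h1 h2
    have h3 := Complex.hasSum_im h1
    rw [zero_add, h2] at h3
    have h4 (n : ℕ) : ((t : ℂ) ^ n • p.coeff n).im = t ^ n • (p.coeff n).im := by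
      rw [← Complex.ofReal_pow, smul_eq_mul, Complex.im_ofReal_mul, smul_eq_mul]
    simpa only [h4] using h3
  have h1 := (hasFPowerSeriesAt_coeffSeries_iff (f := fun _ : ℝ => (0 : ℝ)).2 h0).eq_zero
  have h2 (n : ℕ) : (p.coeff n).im = 0 := by
    have := coeff_coeffSeries (𝕜 := ℝ) (fun n => (p.coeff n).im) n
    rw [h1] at this
    exact this.symm
  refine ⟨fun n => (p.coeff n).re, ?_⟩
  have h3 (n : ℕ) : ((p.coeff n).re : ℂ) = p.coeff n := Complex.ext (by simp) (by simp [h2 n])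
  simpa only [h3, zero_add] using h

/-! ### Matching the limiting eigenvalues with the given indexing -/

theorem finrank_eigenspace_eq_card {H ι : Type*} [AddCommGroup H] [Module ℂ H] [Fintype ι]
    (B : H →ₗ[ℂ] H) (b : Module.Basis ι ℂ H) (μ : ι → ℂ) (hb : ∀ i, B (b i) = μ i • b i) (x : ℂ) :
    Module.finrank ℂ (Module.End.eigenspace B x) = Nat.card {i // μ i = x} := by
  classical
  have hspan : Module.End.eigenspace B x =
      Submodule.span ℂ (Set.range fun i : {i // μ i = x} => b i) := by
    apply le_antisymm
    · intro y hy
      rw [Module.End.mem_eigenspace_iff] at hy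
      have h1 (i : ι) : μ i * b.repr y i = x * b.repr y i := by
        have h2 : B y = ∑ j, (b.repr y j * μ j) • b j := by
          conv_lhs => rw [← b.sum_repr y, map_sum]
          simp only [map_smul, hb, smul_smul]
        have h3 := congrArg (fun v => b.repr v i) hy
        simp only [h2, b.repr_sum_self, map_smul, Finsupp.smul_apply, smul_eq_mul] at h3
        rw [← h3, mul_comm]
      rw [← b.sum_repr y]
      refine Submodule.sum_mem _ fun i _ => ?_
      by_cases hi : μ i = x
      · exact Submodule.smul_mem _ _ (Submodule.subset_span ⟨⟨i, hi⟩, rfl⟩)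
      · have : b.repr y i = 0 := by
          by_contra h
          exact hi (mul_right_cancel₀ h (h1 i))
        rw [this, zero_smul]
        exact Submodule.zero_mem _
    · rw [Submodule.span_le]
      rintro _ ⟨⟨i, rfl⟩, rfl⟩
      exact Module.End.mem_eigenspace_iff.2 (hb i)
  rw [hspan, Nat.card_eq_fintype_card]
  exact finrank_span_eq_card (b.linearIndependent.comp _ Subtype.val_injective)

theorem exists_equiv_of_card_fiber_eq {α β γ : Type*} [Finite α] [Finite β] (f : α → γ) (g : β → γ)
    (h : ∀ x, Nat.card {a // f a = x} = Nat.card {b // g b = x}) :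
    ∃ e : α ≃ β, ∀ a, g (e a) = f a := by
  have hne (x : γ) : Nonempty ({a // f a = x} ≃ {b // g b = x}) := Finite.card_eq.1 (h x)
  refine ⟨((Equiv.sigmaFiberEquiv f).symm.trans
    (Equiv.sigmaCongrRight fun x => (hne x).some)).trans (Equiv.sigmaFiberEquiv g), fun a => ?_⟩
  exact ((hne (f a)).some ⟨a, rfl⟩).2

/-- The eigenvalues of `B`: the nonzero ones `z`, followed by zeros. -/
noncomputable def paddedEigenvalues {H : Type*} [AddCommGroup H] [Module ℂ H] (B : H →ₗ[ℂ] H)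
    (z : Fin (lossRank B) → ℝ) (j : Fin (Module.finrank ℂ H)) : ℂ :=
  if h : (j : ℕ) < lossRank B then (z ⟨j, h⟩ : ℂ) else 0

/-- At `x = 0` this is rank-nullity; elsewhere it is the hypothesis on `z`. -/
theorem card_paddedEigenvalues {H : Type*} [AddCommGroup H] [Module ℂ H] [FiniteDimensional ℂ H]
    (B : H →ₗ[ℂ] H) (z : Fin (lossRank B) → ℝ) (hz : IsNonzeroEigenvalueIndexing B z) (x : ℝ) :
    Nat.card {j // paddedEigenvalues B z j = x} =
      Module.finrank ℂ (Module.End.eigenspace B (x : ℂ)) := by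
  have hle : lossRank B ≤ Module.finrank ℂ H := Submodule.finrank_le _
  by_cases hx : x = 0
  · have h1 : {j // paddedEigenvalues B z j = x} ≃
        {j : Fin (Module.finrank ℂ H) // ¬ (j : ℕ) < lossRank B} := by
      refine Equiv.subtypeEquivRight fun j => ?_
      by_cases h : (j : ℕ) < lossRank B
      · simp [paddedEigenvalues, h, hx, hz.1]
      · simp [paddedEigenvalues, h, hx]
    have h2 : Fintype.card {j : Fin (Module.finrank ℂ H) // (j : ℕ) < lossRank B} = lossRank B := by
      rw [Fintype.card_congr (Fin.castLEquiv hle).symm, Fintype.card_fin]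
    have h3 := LinearMap.finrank_range_add_finrank_ker B
    have h4 : Module.End.eigenspace B ((x : ℝ) : ℂ) = LinearMap.ker B := by
      rw [hx, Complex.ofReal_zero, Module.End.eigenspace_zero]
    rw [Nat.card_congr h1, Nat.card_eq_fintype_card, Fintype.card_subtype_compl, h2, h4,
      Fintype.card_fin, ← h3, lossRank]
    omega
  · rw [← hz.2 x hx]
    refine Nat.card_congr ⟨fun j => ⟨⟨j.1, ?_⟩, ?_⟩, fun j => ⟨⟨j.1, j.1.2.trans_le hle⟩, ?_⟩,
      fun j => rfl, fun j => rfl⟩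
    · by_contra h
      have := j.2
      rw [paddedEigenvalues, dif_neg h] at this
      exact hx (by exact_mod_cast this.symm)
    · have := j.2
      rw [paddedEigenvalues] at this
      split_ifs at this
      · exact_mod_cast this
      · exact absurd (by exact_mod_cast this.symm) hx
    · rw [paddedEigenvalues, dif_pos j.1.2]
      exact_mod_cast j.2

/-! ### Existence of eigenmodes -/

theorem systemOperator_apply {H : Type*} [AddCommGroup H] [Module ℂ H] (Ω B : H →ₗ[ℂ] H)
    {β : ℝ} (hβ : β ≠ 0) (x : H) :
    systemOperator Ω B β x = (-Complex.I * β) • (B x + (Complex.I / β) • Ω x) := by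
  have hβ' : (β : ℂ) ≠ 0 := by exact_mod_cast hβ
  have h : -Complex.I * β * (Complex.I / β) = 1 := by
    field_simp
    simp
  rw [smul_add, smul_smul, h, one_smul, systemOperator]
  simp [sub_eq_add_neg, add_comm]

theorem exists_isEigenmodeFamily {H : Type*} [NormedAddCommGroup H] [InnerProductSpace ℂ H]
    [FiniteDimensional ℂ H] (Ω B : H →ₗ[ℂ] H) (hΩ : Ω.IsSymmetric) (hB : B.IsSymmetric)
    (z : Fin (lossRank B) → ℝ) (hz : IsNonzeroEigenvalueIndexing B z) :
    ∃ (ζ : Fin (Module.finrank ℂ H) → ℝ → ℂ) (w : Fin (Module.finrank ℂ H) → ℝ → H)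
        (c : Fin (Module.finrank ℂ H) → ℕ → H), IsEigenmodeFamily Ω B z ζ w c := by
  have hsa {T : H →ₗ[ℂ] H} (hT : T.IsSymmetric) : IsSelfAdjoint T.toContinuousLinearMap :=
    ContinuousLinearMap.isSelfAdjoint_iff_isSymmetric.2 hT
  obtain ⟨ι, _, v, ν, hcard, hv, hν, hev, hon⟩ :=
    IsAsymptoticallySymmetric.hasAnalyticEigenbasis _ H rfl
      (fun t => B.toContinuousLinearMap + t • Ω.toContinuousLinearMap)
      (analyticAt_const.add (analyticAt_id.smul analyticAt_const))
      ⟨fun _ => 1, tendsto_const_nhds, Eventually.of_forall fun t => ⟨IsSelfAdjoint.one _, by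
        rw [one_mul]
        exact (hsa hB).add (IsSelfAdjoint.smul (by simp [IsSelfAdjoint]) (hsa hΩ))⟩⟩
  simp only [add_apply, smul_apply, LinearMap.coe_toContinuousLinearMap'] at hev
  have hev0 (i : ι) : B (v i 0) = ν i 0 • v i 0 := by
    simpa using (hev i).self_of_nhds
  have hreal (i : ι) : ((ν i 0).re : ℂ) = ν i 0 := by
    refine Complex.conj_eq_iff_re.1 (hB.conj_eigenvalue_eq_self ?_)
    refine Module.End.hasEigenvalue_of_hasEigenvector (x := v i 0)
      ⟨Module.End.mem_eigenspace_iff.2 (hev0 i), ?_⟩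
    exact hon.ne_zero i
  let b : Module.Basis ι ℂ H := basisOfLinearIndependentOfCardEqFinrank' _ hon.linearIndependent hcard
  have hb (i : ι) : b i = v i 0 := by simp [b]
  -- Rellich's eigenvalues at `0` come in no prescribed order. Both lists have the multiplicities of
  -- `B`, so a permutation aligns them.
  obtain ⟨e, he⟩ : ∃ e : Fin (Module.finrank ℂ H) ≃ ι, ∀ j, ν (e j) 0 = paddedEigenvalues B z j := by
    refine exists_equiv_of_card_fiber_eq (paddedEigenvalues B z) (fun i => ν i 0) fun x => ?_
    by_cases hx : x.im = 0
    · have hx' : x = (x.re : ℂ) := Complex.ext (by simp) (by simp [hx])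
      rw [hx', card_paddedEigenvalues B z hz, finrank_eigenspace_eq_card B b (fun i => ν i 0)]
      intro i
      rw [hb, hev0]
    · have h1 : IsEmpty {j // paddedEigenvalues B z j = x} := ⟨fun j => hx (by
        rw [← j.2, paddedEigenvalues]
        split_ifs <;> simp)⟩
      have h2 : IsEmpty {i // ν i 0 = x} := ⟨fun i => hx (by
        rw [← i.2, ← hreal, Complex.ofReal_im])⟩
      rw [Nat.card_of_isEmpty, Nat.card_of_isEmpty]
  choose p hp using hv
  have hsum (j : Fin (Module.finrank ℂ H)) := HasPowerSeriesAtInfty.of_hasSum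
    (by simpa only [zero_add] using hasFPowerSeriesAt_iff.1 (hp (e j)))
  have hc0 (j : Fin (Module.finrank ℂ H)) : (p (e j)).coeff 0 = v (e j) 0 := (hp (e j)).coeff_zero _
  have htend := tendsto_I_div_atTop.mono_right nhdsWithin_le_nhds
  refine ⟨fun j β => -Complex.I * β * ν (e j) (Complex.I / β),
    fun j β => v (e j) (Complex.I / β), fun j n => Complex.I ^ n • (p (e j)).coeff n, ?_⟩
  have hcj (j : Fin (Module.finrank ℂ H)) :
      Complex.I ^ 0 • (p (e j)).coeff 0 = v (e j) 0 := by rw [pow_zero, one_smul, hc0]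
  refine ⟨?_, ?_, hsum, ?_, ?_, ?_⟩
  · have h1 : ∀ᶠ β : ℝ in atTop, ∀ j : Fin (Module.finrank ℂ H), _ :=
      eventually_all.2 fun j => htend.eventually (hev (e j))
    filter_upwards [h1, eventually_ne_atTop 0] with β h hβ j
    rw [systemOperator_apply Ω B hβ, h j, smul_smul]
  -- Linear independence is an open condition and holds in the limit.
  · have h1 : LinearIndependent ℂ (fun j => v (e j) 0) :=
      hon.linearIndependent.comp _ e.injective
    have h2 : Tendsto (fun β : ℝ => fun j => v (e j) (Complex.I / β)) atTop
        (𝓝 fun j => v (e j) 0) :=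
      tendsto_pi_nhds.2 fun j => (hp (e j)).continuousAt.tendsto.comp htend
    exact h2.eventually h1.eventually
  · simp only [hcj]
    exact hon.comp _ e.injective
  · intro j hj
    rw [hcj, hev0, he, paddedEigenvalues, dif_pos hj]
  · intro j hj
    rw [hcj, hev0, he, paddedEigenvalues, dif_neg hj.not_gt, zero_smul]

/-! ### Perturbation coefficients of an analytic eigenvalue -/

theorem eq_at_zero_of_eventually_nhdsNE {X : Type*} [TopologicalSpace X] [T2Space X] {f g : ℂ → X}
    (hf : ContinuousAt f 0) (hg : ContinuousAt g 0) (h : ∀ᶠ t in 𝓝[≠] 0, f t = g t) : f 0 = g 0 :=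
  tendsto_nhds_unique_of_eventuallyEq (hf.tendsto.mono_left nhdsWithin_le_nhds)
    (hg.tendsto.mono_left nhdsWithin_le_nhds) h

theorem exists_eventually_hasSum_succ {E : Type*} [NormedAddCommGroup E] [NormedSpace ℂ E]
    {f : ℂ → E} {a : ℕ → E} (h : ∀ᶠ z in 𝓝 0, HasSum (fun n => z ^ n • a n) (f z)) :
    f 0 = a 0 ∧ ∃ g : ℂ → E, (∀ᶠ z in 𝓝 0, HasSum (fun n => z ^ n • a (n + 1)) (g z)) ∧
      ∀ z, f z = a 0 + z • g z := by
  have h0 : f 0 = a 0 := h.self_of_nhds.unique (HasSum.hasSum_at_zero a)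
  refine ⟨h0, dslope f 0, ?_, fun z => ?_⟩
  · have := hasFPowerSeriesAt_iff.1
      (hasFPowerSeriesAt_coeffSeries_iff.2 h).has_fpower_series_dslope_fslope
    simpa only [FormalMultilinearSeries.coeff_fslope, coeff_coeffSeries, zero_add] using this
  · have := sub_smul_dslope f 0 z
    rw [sub_zero] at this
    rw [this, h0, add_sub_cancel]

section

variable {H : Type*} [NormedAddCommGroup H] [InnerProductSpace ℂ H]
  {Ω B : H →ₗ[ℂ] H}

theorem AnalyticAt.inner_const_left {V : ℂ → H} (x : H) {t : ℂ} (hV : AnalyticAt ℂ V t) :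
    AnalyticAt ℂ (fun s => inner ℂ x (V s)) t :=
  ((innerSL ℂ x).analyticAt _).comp hV

theorem eigenvalue_im_eq_zero (hΩ : Ω.IsSymmetric) (hB : B.IsSymmetric) {t : ℝ} {x : H} {l : ℂ}
    (hx : x ≠ 0) (h : B x + (t : ℂ) • Ω x = l • x) : l.im = 0 := by
  have hT : (B + (t : ℂ) • Ω).IsSymmetric := hB.add (hΩ.smul (by simp))
  refine Complex.conj_eq_iff_im.1 (hT.conj_eigenvalue_eq_self ?_)
  exact Module.End.hasEigenvalue_of_hasEigenvector (x := x)
    ⟨Module.End.mem_eigenspace_iff.2 (by simpa using h), hx⟩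

variable [FiniteDimensional ℂ H]

theorem AnalyticAt.linearMap_apply {V : ℂ → H} (T : H →ₗ[ℂ] H) {t : ℂ} (hV : AnalyticAt ℂ V t) :
    AnalyticAt ℂ (fun s => T (V s)) t :=
  (T.toContinuousLinearMap.analyticAt _).comp hV

/-- If an analytic `V` consists of eigenvectors of `B + tΩ` for some `t` arbitrarily near `0`,
then it does so for all `t` near `0`, and the eigenvalue is analytic. -/
theorem exists_analyticAt_eigenvalue {V : ℂ → H} (hV : AnalyticAt ℂ V 0) (hV0 : ‖V 0‖ = 1)
    (h : ∃ᶠ t in 𝓝[≠] (0 : ℂ), ∃ l : ℂ, B (V t) + t • Ω (V t) = l • V t) :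
    ∃ ν : ℂ → ℂ, AnalyticAt ℂ ν 0 ∧ ∀ᶠ t in 𝓝 0, B (V t) + t • Ω (V t) = ν t • V t := by
  have hL : AnalyticAt ℂ (fun t => B (V t) + t • Ω (V t)) 0 :=
    (hV.linearMap_apply B).add (analyticAt_id.smul (hV.linearMap_apply Ω))
  have he := hV.inner_const_left (V 0)
  have he0 : inner ℂ (V 0) (V 0) ≠ 0 := by simp [inner_self_eq_norm_sq_to_K, hV0]
  -- Pairing the eigenvector equation with `V 0` forces this quotient, whose denominator is nonzero
  -- near `0`.
  have hν : AnalyticAt ℂ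
      (fun t => inner ℂ (V 0) (B (V t) + t • Ω (V t)) / inner ℂ (V 0) (V t)) 0 :=
    (hL.inner_const_left (V 0)).div he he0
  refine ⟨_, hν, (hL.frequently_eq_iff_eventually_eq (hν.smul hV)).1 ?_⟩
  have hne : ∀ᶠ t in 𝓝[≠] (0 : ℂ), inner ℂ (V 0) (V t) ≠ 0 :=
    nhdsWithin_le_nhds (he.continuousAt.eventually_ne he0)
  refine (h.and_eventually hne).mono ?_
  rintro t ⟨⟨l, hl⟩, ht⟩
  simp only [hl, inner_smul_right, Pi.smul_apply']
  rw [mul_div_cancel_right₀ _ ht]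

/-- The first terms of the perturbation series of an eigenvalue of `B + tΩ`. -/
theorem eigenvalue_coeff (hΩ : Ω.IsSymmetric) (hB : B.IsSymmetric) {V : ℂ → H} {v : ℕ → H}
    {ν : ℂ → ℂ} {r : ℕ → ℝ} {x : ℝ} (hv : ∀ᶠ t in 𝓝 0, HasSum (fun n => t ^ n • v n) (V t))
    (hr : ∀ᶠ t in 𝓝 0, HasSum (fun n => t ^ n • (r n : ℂ)) (ν t))
    (hv0 : ‖v 0‖ = 1) (hx : B (v 0) = (x : ℂ) • v 0)
    (h : ∀ᶠ t in 𝓝 0, B (V t) + t • Ω (V t) = ν t • V t) :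
    r 0 = x ∧ (r 1 : ℂ) = inner ℂ (v 0) (Ω (v 0)) ∧
      (x = 0 → (r 2 : ℂ) = -inner ℂ (v 1) (B (v 1))) := by
  obtain ⟨hV0, V₁, hV₁, hV⟩ := exists_eventually_hasSum_succ hv
  obtain ⟨hν0, n₁, hn₁, hν⟩ := exists_eventually_hasSum_succ hr
  obtain ⟨hV₁0, -⟩ := exists_eventually_hasSum_succ hV₁
  obtain ⟨hn₁0, n₂, hn₂, hn⟩ := exists_eventually_hasSum_succ hn₁
  obtain ⟨hn₂0, -⟩ := exists_eventually_hasSum_succ hn₂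
  simp only [zero_add] at hV₁0 hn₁0 hn₂0 hn
  have hVan : AnalyticAt ℂ V 0 := ⟨_, hasFPowerSeriesAt_coeffSeries_iff.2 hv⟩
  have hV₁an : AnalyticAt ℂ V₁ 0 := ⟨_, hasFPowerSeriesAt_coeffSeries_iff.2 hV₁⟩
  have hn₁an : AnalyticAt ℂ n₁ 0 := ⟨_, hasFPowerSeriesAt_coeffSeries_iff.2 hn₁⟩
  have hn₂an : AnalyticAt ℂ n₂ 0 := ⟨_, hasFPowerSeriesAt_coeffSeries_iff.2 hn₂⟩
  have hv00 : inner ℂ (v 0) (v 0) = 1 := by simp [inner_self_eq_norm_sq_to_K, hv0]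
  have hvne : v 0 ≠ 0 := fun h0 => by simp [h0] at hv0
  have h0 : (r 0 : ℂ) = x := by
    have := h.self_of_nhds
    rw [zero_smul, add_zero, hV0, hν0, hx] at this
    exact (smul_left_injective ℂ hvne this).symm
  -- The coefficient of `t`, obtained by dividing by `t` and letting `t → 0`.
  have h1 : B (v 1) + Ω (v 0) = (x : ℂ) • v 1 + (r 1 : ℂ) • v 0 := by
    have := eq_at_zero_of_eventually_nhdsNE
      (f := fun t => B (V₁ t) + Ω (V t)) (g := fun t => (x : ℂ) • V₁ t + n₁ t • V t)
      ((hV₁an.linearMap_apply B).add (hVan.linearMap_apply Ω)).continuousAt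
      ((analyticAt_const.smul hV₁an).add (hn₁an.smul hVan)).continuousAt ?_
    · simpa only [hV₁0, hV0, hn₁0] using this
    filter_upwards [nhdsWithin_le_nhds h, self_mem_nhdsWithin] with t ht ht0
    refine smul_right_injective H (r := t) ht0 ?_
    have h2 : B (V t) = (x : ℂ) • v 0 + t • B (V₁ t) := by rw [hV, map_add, map_smul, hx]
    have h3 : ν t • V t = (x : ℂ) • (v 0 + t • V₁ t) + (t * n₁ t) • V t := by
      rw [← hV, hν, h0, smul_eq_mul, add_smul]
    rw [h2, h3] at ht
    simp only [smul_add, mul_smul, smul_comm t (x : ℂ)] at ht ⊢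
    rw [add_assoc, add_assoc] at ht
    exact add_left_cancel ht
  have hBv (y : H) : inner ℂ (v 0) (B y) = x * inner ℂ (v 0) y := by
    rw [← hB, hx, inner_smul_left, Complex.conj_ofReal]
  have h2 : (r 1 : ℂ) = inner ℂ (v 0) (Ω (v 0)) := by
    have := congrArg (inner ℂ (v 0)) h1
    rw [inner_add_right, inner_add_right, inner_smul_right, inner_smul_right, hBv, hv00,
      mul_one] at this
    exact (add_left_cancel this).symm
  refine ⟨by exact_mod_cast h0, h2, fun hx0 => ?_⟩
  subst hx0
  -- The coefficient of `t²` paired with `v 0`; the `B` term drops out because `B (v 0) = 0`.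
  have h3 : inner ℂ (v 0) (Ω (v 1)) = r 1 * inner ℂ (v 0) (v 1) + r 2 := by
    have := eq_at_zero_of_eventually_nhdsNE
      (f := fun t => inner ℂ (v 0) (Ω (V₁ t)))
      (g := fun t => n₁ t * inner ℂ (v 0) (V₁ t) + n₂ t)
      ((hV₁an.linearMap_apply Ω).inner_const_left _).continuousAt
      ((hn₁an.mul (hV₁an.inner_const_left _)).add hn₂an).continuousAt ?_
    · simpa only [hV₁0, hn₁0, hn₂0] using this
    filter_upwards [nhdsWithin_le_nhds h, self_mem_nhdsWithin] with t ht ht0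
    have h4 := congrArg (inner ℂ (v 0)) ht
    rw [inner_add_right, inner_smul_right, inner_smul_right, hBv, hν, h0, Complex.ofReal_zero,
      zero_mul, zero_add, zero_add, smul_eq_mul, mul_assoc] at h4
    have h5 := mul_left_cancel₀ ht0 h4
    have h6 : inner ℂ (v 0) (Ω (V t)) = r 1 + t * inner ℂ (v 0) (Ω (V₁ t)) := by
      rw [hV, map_add, map_smul, inner_add_right, inner_smul_right, h2]
    have h7 : inner ℂ (v 0) (V t) = 1 + t * inner ℂ (v 0) (V₁ t) := by
      rw [hV, inner_add_right, inner_smul_right, hv00]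
    rw [h6, h7] at h5
    refine mul_left_cancel₀ ht0 ?_
    have h8 := hn t
    rw [smul_eq_mul] at h8
    linear_combination h5 + h8
  -- Pairing the first-order equation with `v 1` produces the same `r 1 * ⟨v 0, v 1⟩`, which
  -- cancels; no normalisation of `v 1` is needed.
  have h4 := congrArg (fun y => inner ℂ y (v 1)) h1
  simp only [Complex.ofReal_zero, zero_smul, zero_add, inner_add_left, inner_smul_left,
    Complex.conj_ofReal] at h4
  rw [hB, hΩ] at h4
  linear_combination -h3 + h4

end

/-! ### Real and imaginary parts of the eigenvalues at infinity -/

theorem HasPowerSeriesAtInfty.re {f : ℝ → ℂ} {c : ℕ → ℂ} (h : HasPowerSeriesAtInfty f c) :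
    HasPowerSeriesAtInfty (fun β => (f β).re) (fun n => (c n).re) := by
  obtain ⟨R, hR, h⟩ := h
  refine ⟨R, hR, fun β hβ => ?_⟩
  simpa only [Complex.smul_re] using Complex.hasSum_re (h β hβ)

theorem HasPowerSeriesAtInfty.im {f : ℝ → ℂ} {c : ℕ → ℂ} (h : HasPowerSeriesAtInfty f c) :
    HasPowerSeriesAtInfty (fun β => (f β).im) (fun n => (c n).im) := by
  obtain ⟨R, hR, h⟩ := h
  refine ⟨R, hR, fun β hβ => ?_⟩
  simpa only [Complex.smul_im] using Complex.hasSum_im (h β hβ)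

theorem HasPowerSeriesAtInfty.congr {E : Type*} [NormedAddCommGroup E] [NormedSpace ℝ E]
    {f g : ℝ → E} {c : ℕ → E} (h : HasPowerSeriesAtInfty f c) (hfg : f =ᶠ[atTop] g) :
    HasPowerSeriesAtInfty g c := by
  rw [hasPowerSeriesAtInfty_iff] at h ⊢
  filter_upwards [h, hfg] with β h1 h2
  rwa [← h2]

/-- The Laurent series of a function with a simple pole at infinity. -/
theorem HasPowerSeriesAtInfty.hasLaurentSeriesAtInfty {f : ℝ → ℝ} {b : ℕ → ℝ} {x : ℝ}
    (h : HasPowerSeriesAtInfty (fun β => f β - x * β) b) :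
    HasLaurentSeriesAtInfty f
      (fun n => if 0 ≤ n then b n.toNat else if n = -1 then x else 0) := by
  obtain ⟨R, hR, h⟩ := h
  refine ⟨⟨-1, fun n hn => ?_⟩, R, hR, fun β hβ => ?_⟩
  · simp only [if_neg (show ¬0 ≤ n by omega), if_neg (show ¬n = -1 by omega)]
  have h1 : HasSum (fun n : ℕ => (if n = 0 then x * β else 0)) (x * β) := hasSum_ite_eq 0 _
  -- The negative indices are `-(n + 1)`, so the pole term sits at `n = 0`.
  have h2 := HasSum.of_nat_of_neg_add_one
    (f := fun n : ℤ => (if 0 ≤ n then b n.toNat else if n = -1 then x else 0) * β ^ (-n))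
    (m := f β - x * β) (m' := x * β)
    (by
      refine (congrArg (HasSum · _) (funext fun n => ?_)).mp (h β hβ)
      simp [mul_comm])
    (by
      refine (congrArg (HasSum · _) (funext fun n => ?_)).mpr h1
      rw [if_neg (by omega)]
      by_cases hn : n = 0
      · simp [hn]
      · rw [if_neg (by omega), if_neg hn, zero_mul])
  rwa [sub_add_cancel] at h2

theorem even_of_I_pow_re_ne_zero {n : ℕ} (h : (Complex.I ^ n).re ≠ 0) : Even n := by
  by_contra hn
  rw [Nat.not_even_iff_odd] at hn
  obtain ⟨k, rfl⟩ := hn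
  apply h
  rw [pow_succ, pow_mul, Complex.I_sq, ← Complex.ofReal_one, ← Complex.ofReal_neg,
    ← Complex.ofReal_pow, Complex.re_ofReal_mul, Complex.I_re, mul_zero]

theorem odd_of_I_pow_im_ne_zero {n : ℕ} (h : (Complex.I ^ n).im ≠ 0) : Odd n := by
  by_contra hn
  rw [Nat.not_odd_iff_even] at hn
  obtain ⟨k, rfl⟩ := hn.two_dvd
  apply h
  rw [pow_mul, Complex.I_sq, ← Complex.ofReal_one, ← Complex.ofReal_neg,
    ← Complex.ofReal_pow, Complex.ofReal_im]

/-- The expansion at `β = ∞` of an eigenvalue `ζ(β) = -iβ ν(i/β)`, where `ν` has real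
coefficients. -/
theorem hasPowerSeriesAtInfty_eigenvalue {ζ : ℝ → ℂ} {ν : ℂ → ℂ} {r : ℕ → ℝ}
    (hr : ∀ᶠ t in 𝓝 0, HasSum (fun n => t ^ n • (r n : ℂ)) (ν t))
    (hζ : ∀ᶠ β : ℝ in atTop, ζ β = -Complex.I * β * ν (Complex.I / β)) :
    HasPowerSeriesAtInfty (fun β => (ζ β).re) (fun n => (Complex.I ^ n).re * r (n + 1)) ∧
      HasPowerSeriesAtInfty (fun β => (ζ β).im - -r 0 * β)
        (fun n => (Complex.I ^ n).im * r (n + 1)) := by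
  obtain ⟨-, g, hg, hν⟩ := exists_eventually_hasSum_succ hr
  have hG := HasPowerSeriesAtInfty.of_hasSum hg
  -- From `ν(t) = r 0 + t g(t)` and `-iβ t = 1`; adding `i r 0 β` removes the pole.
  have key : ∀ᶠ β : ℝ in atTop, g (Complex.I / β) = ζ β + Complex.I * (r 0 * β : ℝ) := by
    filter_upwards [hζ, eventually_ne_atTop 0] with β h1 hβ
    have hβ' : (β : ℂ) ≠ 0 := by exact_mod_cast hβ
    rw [h1, hν, smul_eq_mul]
    push_cast
    field_simp
    linear_combination g (Complex.I / β) * Complex.I_sq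
  constructor
  · have := (hG.re.congr (g := fun β => (ζ β).re) (by
      filter_upwards [key] with β h1
      simp [h1]))
    simpa using this
  · have := (hG.im.congr (g := fun β => (ζ β).im - -r 0 * β) (by
      filter_upwards [key] with β h1
      simp [h1]))
    simpa using this

/-- The eigenvalue of an analytic eigenmode of `A(β)` is `-iβ ν(i/β)` for a power series `ν` with
real coefficients. -/
theorem IsEigenmodeFamily.exists_eigenvalue_series {H : Type*} [NormedAddCommGroup H]
    [InnerProductSpace ℂ H] [FiniteDimensional ℂ H] {Ω B : H →ₗ[ℂ] H} (hΩ : Ω.IsSymmetric)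
    (hB : B.IsSymmetric) {z : Fin (lossRank B) → ℝ} {ζ : Fin (Module.finrank ℂ H) → ℝ → ℂ}
    {w : Fin (Module.finrank ℂ H) → ℝ → H} {c : Fin (Module.finrank ℂ H) → ℕ → H}
    (h : IsEigenmodeFamily Ω B z ζ w c) (j : Fin (Module.finrank ℂ H)) {x : ℝ}
    (hx : B (c j 0) = (x : ℂ) • c j 0) :
    ∃ r : ℕ → ℝ,
      HasPowerSeriesAtInfty (fun β => (ζ j β).re) (fun n => (Complex.I ^ n).re * r (n + 1)) ∧
      HasPowerSeriesAtInfty (fun β => (ζ j β).im - -r 0 * β)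
        (fun n => (Complex.I ^ n).im * r (n + 1)) ∧
      r 0 = x ∧ r 1 = (inner ℂ (c j 0) (Ω (c j 0))).re ∧
      (x = 0 → r 2 = -(inner ℂ (c j 1) (B (c j 1))).re) := by
  have : CompleteSpace H := FiniteDimensional.complete ℂ H
  obtain ⟨V, hV, hw⟩ := (h.analytic j).exists_hasSum
  have hVan : AnalyticAt ℂ V 0 := ⟨_, hasFPowerSeriesAt_coeffSeries_iff.2 hV⟩
  have hV0 : V 0 = c j 0 := by
    rw [(exists_eventually_hasSum_succ hV).1, pow_zero, one_smul]
  have hc0 : ‖c j 0‖ = 1 := h.orthonormal.1 j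
  have hVne : ∀ᶠ t in 𝓝 0, V t ≠ 0 := hVan.continuousAt.eventually_ne (by
    rw [hV0]
    exact h.orthonormal.ne_zero j)
  have heig : ∀ᶠ β : ℝ in atTop, (-Complex.I * β) •
      (B (V (Complex.I / β)) + (Complex.I / β) • Ω (V (Complex.I / β))) =
        ζ j β • V (Complex.I / β) := by
    filter_upwards [h.eigenpair, hw, eventually_ne_atTop 0] with β h1 h2 hβ
    have h3 := h1 j
    rwa [systemOperator_apply Ω B hβ, h2] at h3
  obtain ⟨ν, hν, hev⟩ := exists_analyticAt_eigenvalue (Ω := Ω) (B := B) hVan (by rw [hV0, hc0])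
    (tendsto_I_div_atTop.frequently (Eventually.frequently (by
      filter_upwards [heig, eventually_ne_atTop 0] with β h1 hβ
      have hβ' : -Complex.I * (β : ℂ) ≠ 0 := by simp [hβ]
      exact ⟨(-Complex.I * β)⁻¹ * ζ j β, by rw [mul_smul, ← h1, inv_smul_smul₀ hβ']⟩)))
  have hreal : Tendsto (fun t : ℝ => (t : ℂ)) (𝓝 0) (𝓝 0) := by
    have := Complex.continuous_ofReal.tendsto 0
    rwa [Complex.ofReal_zero] at this
  obtain ⟨r, hr⟩ := exists_real_coeff hν (by
    filter_upwards [hreal.eventually hev, hreal.eventually hVne] with t h1 h2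
    exact eigenvalue_im_eq_zero hΩ hB h2 h1)
  have hζ : ∀ᶠ β : ℝ in atTop, ζ j β = -Complex.I * β * ν (Complex.I / β) := by
    have htend := tendsto_I_div_atTop.mono_right nhdsWithin_le_nhds
    filter_upwards [heig, htend.eventually hev, htend.eventually hVne] with β h1 h2 h3
    rw [h2, smul_smul] at h1
    exact (smul_left_injective ℂ h3 h1).symm
  obtain ⟨hre, him⟩ := hasPowerSeriesAtInfty_eigenvalue hr hζ
  obtain ⟨h0, h1, h2⟩ := eigenvalue_coeff (x := x) hΩ hB hV hr (by simpa using hc0)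
    (by simpa using hx) hev
  refine ⟨r, hre, him, h0, ?_, fun hx0 => ?_⟩
  · have := congrArg Complex.re h1
    simpa using this
  -- In the variable `t` the first-order vector is `-i c j 1`; the phase has modulus one and cancels
  -- in the quadratic form.
  · have := congrArg Complex.re (h2 hx0)
    rw [Complex.ofReal_re, pow_one, map_smul, inner_smul_left, inner_smul_right, ← mul_assoc] at this
    simpa using this

theorem mainTheorem3 {H : Type*} [NormedAddCommGroup H] [InnerProductSpace ℂ H]
    [FiniteDimensional ℂ H] (Ω B : H →ₗ[ℂ] H) (hΩ : Ω.IsSymmetric) (hB : B.IsPositive)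
    (hB0 : 0 < lossRank B) (hB1 : lossRank B < Module.finrank ℂ H)
    (z : Fin (lossRank B) → ℝ) (hz : IsNonzeroEigenvalueIndexing B z) :
    (∃ (ζ : Fin (Module.finrank ℂ H) → ℝ → ℂ) (w : Fin (Module.finrank ℂ H) → ℝ → H)
        (c : Fin (Module.finrank ℂ H) → ℕ → H), IsEigenmodeFamily Ω B z ζ w c) ∧
    ∀ (ζ : Fin (Module.finrank ℂ H) → ℝ → ℂ) (w : Fin (Module.finrank ℂ H) → ℝ → H)
        (c : Fin (Module.finrank ℂ H) → ℕ → H), IsEigenmodeFamily Ω B z ζ w c →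
      -- the real parts are analytic at infinity, with even powers only
      (∀ j, ∃ a : ℕ → ℝ, HasPowerSeriesAtInfty (fun β => (ζ j β).re) a ∧
        ∀ n, a n ≠ 0 → Even n) ∧
      -- the imaginary parts of the high-loss modes have poles, with odd powers only
      (∀ j : Fin (Module.finrank ℂ H), (j : ℕ) < lossRank B →
        ∃ a : ℤ → ℝ, HasLaurentSeriesAtInfty (fun β => (ζ j β).im) a ∧
          (∃ n : ℤ, n < 0 ∧ a n ≠ 0) ∧ ∀ n, a n ≠ 0 → Odd n) ∧
      -- the imaginary parts of the low-loss modes are analytic, with odd powers only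
      (∀ j : Fin (Module.finrank ℂ H), lossRank B ≤ (j : ℕ) →
        ∃ a : ℕ → ℝ, HasPowerSeriesAtInfty (fun β => (ζ j β).im) a ∧
          ∀ n, a n ≠ 0 → Odd n) ∧
      -- the leading terms
      (∀ j, (fun β : ℝ => (ζ j β).re - (inner ℂ (c j 0) (Ω (c j 0))).re)
        =O[atTop] fun β : ℝ => β ^ (-2 : ℤ)) ∧
      (∀ (j : Fin (Module.finrank ℂ H)) (hj : (j : ℕ) < lossRank B),
        (fun β : ℝ => (ζ j β).im - -(z ⟨j, hj⟩ * β)) =O[atTop] fun β : ℝ => β ^ (-1 : ℤ)) ∧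
      (∀ j : Fin (Module.finrank ℂ H), lossRank B ≤ (j : ℕ) →
        (fun β : ℝ => (ζ j β).im - -((inner ℂ (c j 1) (B (c j 1))).re / β))
          =O[atTop] fun β : ℝ => β ^ (-3 : ℤ)) := by

  have hBs := hB.isSymmetric
  refine ⟨exists_isEigenmodeFamily Ω B hΩ hBs z hz, fun ζ w c h => ?_⟩
  have high (j : Fin (Module.finrank ℂ H)) (hj : (j : ℕ) < lossRank B) :=
    h.exists_eigenvalue_series hΩ hBs j (h.highLoss j hj)
  have low (j : Fin (Module.finrank ℂ H)) (hj : lossRank B ≤ (j : ℕ)) :=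
    h.exists_eigenvalue_series hΩ hBs j (x := 0) (by simpa using h.lowLoss j hj)
  have all (j : Fin (Module.finrank ℂ H)) : ∃ r : ℕ → ℝ,
      HasPowerSeriesAtInfty (fun β => (ζ j β).re) (fun n => (Complex.I ^ n).re * r (n + 1)) ∧
      r 1 = (inner ℂ (c j 0) (Ω (c j 0))).re := by
    rcases lt_or_ge (j : ℕ) (lossRank B) with hj | hj
    · obtain ⟨r, h1, -, -, h2, -⟩ := high j hj
      exact ⟨r, h1, h2⟩
    · obtain ⟨r, h1, -, -, h2, -⟩ := low j hj
      exact ⟨r, h1, h2⟩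
  refine ⟨fun j => ?_, fun j hj => ?_, fun j hj => ?_, fun j => ?_, fun j hj => ?_, fun j hj => ?_⟩
  · obtain ⟨r, hre, -⟩ := all j
    exact ⟨_, hre, fun n hn => even_of_I_pow_re_ne_zero (left_ne_zero_of_mul hn)⟩
  · obtain ⟨r, -, him, h0, -⟩ := high j hj
    refine ⟨_, him.hasLaurentSeriesAtInfty, ⟨-1, by norm_num, ?_⟩, fun n hn => ?_⟩
    · simpa [h0] using hz.1 ⟨j, hj⟩
    · by_cases h1 : 0 ≤ n
      · simp only [if_pos h1] at hn
        obtain ⟨k, hk⟩ := odd_of_I_pow_im_ne_zero (left_ne_zero_of_mul hn)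
        exact ⟨k, by omega⟩
      · by_cases h2 : n = -1
        · exact ⟨-1, by omega⟩
        · simp [h1, h2] at hn
  · obtain ⟨r, -, him, h0, -⟩ := low j hj
    simp only [h0, neg_zero, zero_mul, sub_zero] at him
    exact ⟨_, him, fun n hn => odd_of_I_pow_im_ne_zero (left_ne_zero_of_mul hn)⟩
  · obtain ⟨r, hre, h1⟩ := all j
    -- The `β⁻¹` coefficient vanishes since `Re i = 0`, so the error is already of order two.
    simpa [Finset.sum_range_succ, h1] using hre.isBigO_sub_sum 2
  · obtain ⟨r, -, him, h0, -⟩ := high j hj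
    simpa [Finset.sum_range_succ, h0] using him.isBigO_sub_sum 1
  · obtain ⟨r, -, him, h0, -, h2⟩ := low j hj
    -- Orders `0` and `2` vanish, as `i^0` and `i^2` are real; order `1` contributes `r 2`.
    simpa [Finset.sum_range_succ, h0, h2 rfl, div_eq_inv_mul] using him.isBigO_sub_sum 3
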